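/- Let $a,n\in\mathbb N$, let $\underline U^j<\overline U^j$ be real numbers for $j=1,\dots,a$, and for $i=1,\dots,n$ put $$\Omega_i=[\underline U^1,\overline U^1]^i\times\cdots\times[\underline U^a,\overline U^a]^i\subset\mathbb R^{ia}.$$ Let $\psi:\mathbb R\to\mathbb R$ be either the ReLU function $\psi(t)=\max(t,0)$ or a continuously differentiable function that is not a polynomial. A ridge network is a function $f:\mathbb R^{ia}\to\mathbb R^a$ of the form $f(x)=\sum_{m=1}^{N}\alpha_m\,\psi(w_m\cdot x-b_m)$ with $N\in\mathbb N$, $\alpha_m\in\mathbb R^a$, $w_m\in\mathbb R^{ia}$ and $b_m\in\mathbb R$. For $B>0$ and $L>0$ let $\mathrm{Ridge}_{i,B,L}$ be the set of all ridge networks $f=(f_1,\dots,f_a)$ such that, for every $j=1,\dots,a$, the restriction $f_j|_{\Omega_i}$ is $L$-Lipschitz (with respect to the Euclidean norm) and $\sup_{x\in\Omega_i}|f_j(x)|\le B$. Then, for every $i=1,\dots,n$, all $B>0$ and all $L>0$, the set $\{f|_{\Omega_i} : f\in\mathrm{Ridge}_{i,B,L}\}$ is a dense subset, with respect to the topology of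 uniform convergence on $\Omega_i$, of the set of all functions $f=(f_1,\dots,f_a):\Omega_i\to\mathbb R^a$ such that, for every $j=1,\dots,a$, the component $f_j$ is $L$-Lipschitz and $\sup_{x\in\Omega_i}|f_j(x)|\le B$. -/

import Mathlib

open scoped NNReal UniformConvergence

noncomputable section

namespace RidgeDensity

/-- The space `ℝ^{ia}` of the price paths of `a` assets up to the `i`-th trading time, with the
Euclidean norm; the coordinate `(j, k)` is the price of asset `j` at the `k`-th time. -/
abbrev PathSpace (a i : ℕ) : Type := EuclideanSpace ℝ (Fin a × Fin i)

/-- The box `Ω_i = [lo¹, hi¹]^i × ⋯ × [lo^a, hi^a]^i ⊂ ℝ^{ia}`. -/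
def priceBox {a : ℕ} (lo hi : Fin a → ℝ) (i : ℕ) : Set (PathSpace a i) :=
  {x | ∀ (j : Fin a) (k : Fin i), x (j, k) ∈ Set.Icc (lo j) (hi j)}

/-- The rectified linear unit. -/
def relu (t : ℝ) : ℝ := max t 0

/-- The activation is either ReLU or a continuously differentiable function that is not
a polynomial. -/
def AdmissibleActivation (ψ : ℝ → ℝ) : Prop :=
  ψ = relu ∨ (ContDiff ℝ 1 ψ ∧ ¬ ∃ p : Polynomial ℝ, ∀ t, ψ t = p.eval t)

/-- The ridgelet function `x ↦ ψ (w · x - b)`. -/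
def ridgelet {ι : Type*} [Fintype ι] (ψ : ℝ → ℝ) (w : EuclideanSpace ℝ ι) (b : ℝ)
    (x : EuclideanSpace ℝ ι) : ℝ :=
  ψ (inner ℝ w x - b)

/-- The class of ridge networks: all finite linear combinations of ridgelet functions with
coefficients in `ℝ^d`. The coordinates of the input are indexed by `ι`. -/
def Ridge (ι : Type*) [Fintype ι] (d : ℕ) (ψ : ℝ → ℝ) :
    Set (EuclideanSpace ℝ ι → EuclideanSpace ℝ (Fin d)) :=
  {f | ∃ (N : ℕ) (α : Fin N → EuclideanSpace ℝ (Fin d)) (w : Fin N → EuclideanSpace ℝ ι)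
      (b : Fin N → ℝ), ∀ x, f x = ∑ m, ridgelet ψ (w m) (b m) x • α m}

/-- The ridge networks on `ℝ^{ia}` with values in `ℝ^a` each component of which is `L`-Lipschitz
and bounded by `B` on `Ω_i`. -/
def RidgeBL {a : ℕ} (lo hi : Fin a → ℝ) (ψ : ℝ → ℝ) (i : ℕ) (B : ℝ) (L : ℝ≥0) :
    Set (PathSpace a i → EuclideanSpace ℝ (Fin a)) :=
  {f | f ∈ Ridge (Fin a × Fin i) a ψ ∧
    ∀ j : Fin a, LipschitzOnWith L (fun x => f x j) (priceBox lo hi i) ∧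
      ∀ x ∈ priceBox lo hi i, |f x j| ≤ B}

/-- The restrictions to `Ω_i` of the networks in `RidgeBL`, as a subset of the space of all
functions `Ω_i → ℝ^a` with the topology of uniform convergence. -/
def ridgeRestrict {a : ℕ} (lo hi : Fin a → ℝ) (ψ : ℝ → ℝ) (i : ℕ) (B : ℝ) (L : ℝ≥0) :
    Set (priceBox lo hi i →ᵤ EuclideanSpace ℝ (Fin a)) :=
  {g | ∃ f ∈ RidgeBL lo hi ψ i B L, g = UniformFun.ofFun (fun x => f x.1)}

/-- The functions `Ω_i → ℝ^a` each component of which is `L`-Lipschitz and bounded by `B`, as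
a subset of the space of all functions `Ω_i → ℝ^a` with the topology of uniform convergence. -/
def lipBounded {a : ℕ} (lo hi : Fin a → ℝ) (i : ℕ) (B : ℝ) (L : ℝ≥0) :
    Set (priceBox lo hi i →ᵤ EuclideanSpace ℝ (Fin a)) :=
  {f | ∀ j : Fin a, LipschitzWith L (fun x => UniformFun.toFun f x j) ∧
    ∀ x, |UniformFun.toFun f x j| ≤ B}

end RidgeDensity

end

/-!
Shrink a component `u` by a factor `1 - θ`, so that its Lipschitz constant and its bound are
strictly smaller than allowed. It then suffices to approximate `(1 - θ) u` uniformly by some `v`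
with the same two constants, and `v` by a ridge network in the stronger norm
`max (sup norm) (Lipschitz constant)` on the box (`exists_mem_ridgeSpan_approx`).

For the first approximation, extend `u` to the whole space with bounded support and the same
constants (`exists_lipschitz_extension`), and average its translates with the weight `κ ^ n` on a
large ball, where `κ t = C - ∑ j, cosh (t j)` peaks only at the origin. Averaging translates
preserves both constants, and the averages converge uniformly as `n → ∞`. Since `κ ^ n` is a
combination of exponentials and the support of `u` is bounded, each average agrees on the box with
a finite combination of exponentials `x ↦ exp ⟪w, x⟫` (`exists_mem_expSpan_approx`).

For the second approximation, it is enough to approximate the one-variable function `exp` on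
`[-R, R]`, in the stronger norm, by combinations of `t ↦ ψ (s * t - b)`, that is, to approximate
its derivative uniformly (`exp_mem_lipClosure`). For the rectified linear unit this is piecewise
linear interpolation. For a continuously differentiable `ψ`, the derivative `σ = ψ'` is continuous
and not a polynomial, and the functions `t ↦ σ (s * t + b)` span a dense subspace of
`C([-R, R])` (`affineSpan_eq_top`): if `η` is a mollification of `σ`, then the `k`-th derivative of
`s ↦ η (s * t + b)` at `s = 0` shows that `t ^ k * η⁽ᵏ⁾ b` lies in the closed span. If some `t ^ k`
were not in the closed span, all mollifications would be polynomials of degree at most `k`, and so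
would be their pointwise limit `σ`.
-/

namespace RidgeDensity

open Polynomial Filter Topology MeasureTheory

/-! ### Functions with a vanishing derivative of some order, and limits of polynomials -/

theorem exists_derivative_eq (q : ℝ[X]) : ∃ p : ℝ[X], derivative p = q := by
  induction q using Polynomial.induction_on' with
  | add p q hp hq =>
    obtain ⟨P, rfl⟩ := hp
    obtain ⟨Q, rfl⟩ := hq
    exact ⟨P + Q, derivative_add⟩
  | monomial n c =>
    refine ⟨monomial (n + 1) (c / (n + 1)), ?_⟩
    have : (n : ℝ) + 1 ≠ 0 := by positivity
    rw [derivative_monomial]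
    push_cast
    rw [div_mul_cancel₀ _ this]

theorem exists_eq_eval_of_deriv_eq_eval {f : ℝ → ℝ} (hf : Differentiable ℝ f) {q : ℝ[X]}
    (h : ∀ t, deriv f t = q.eval t) :
    ∃ p : ℝ[X], p.natDegree ≤ q.natDegree + 1 ∧ ∀ t, f t = p.eval t := by
  obtain ⟨Q, rfl⟩ := exists_derivative_eq q
  have hd : Differentiable ℝ (fun t => f t - Q.eval t) := hf.sub Q.differentiable
  have hc := is_const_of_deriv_eq_zero hd (fun t => by
    rw [deriv_fun_sub (hf t) Q.differentiableAt, h, Polynomial.deriv, sub_self])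
  refine ⟨Q + C (f 0 - Q.eval 0), ?_, fun t => ?_⟩
  · rw [natDegree_add_C]
    by_contra! hlt
    have hQ : Q ≠ 0 := by
      rintro rfl
      simp at hlt
    have hcoeff : (derivative Q).coeff (Q.natDegree - 1) ≠ 0 := by
      rw [coeff_derivative, Nat.sub_add_cancel (by omega)]
      exact mul_ne_zero (leadingCoeff_ne_zero.2 hQ) (by positivity)
    have := le_natDegree_of_ne_zero hcoeff
    omega
  · have := hc t 0
    simp only [eval_add, eval_C]
    linarith

theorem exists_eq_eval_of_iteratedDeriv_eq_zero (k : ℕ) {f : ℝ → ℝ} (hf : ContDiff ℝ k f)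
    (h : ∀ t, iteratedDeriv k f t = 0) :
    ∃ p : ℝ[X], p.natDegree ≤ k ∧ ∀ t, f t = p.eval t := by
  induction k generalizing f with
  | zero => exact ⟨0, by simp, fun t => by simpa using h t⟩
  | succ k ih =>
    have hf' : ContDiff ℝ (k + 1) f := by exact_mod_cast hf
    obtain ⟨q, hq, hqf⟩ := ih (f := deriv f) (contDiff_succ_iff_deriv.1 hf').2.2
      (fun t => by rw [← iteratedDeriv_succ', h])
    obtain ⟨p, hp, hpf⟩ := exists_eq_eval_of_deriv_eq_eval
      (contDiff_succ_iff_deriv.1 hf').1 hqf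
    exact ⟨p, by omega, hpf⟩

/-- A pointwise limit of polynomials of bounded degree is a polynomial: the Lagrange interpolation
formula at fixed nodes passes to the limit. -/
theorem exists_eq_eval_of_tendsto {σ : ℝ → ℝ} (k : ℕ) {p : ℕ → ℝ[X]}
    (hp : ∀ n, (p n).natDegree ≤ k) (h : ∀ t, Tendsto (fun n => (p n).eval t) atTop (𝓝 (σ t))) :
    ∃ q : ℝ[X], ∀ t, σ t = q.eval t := by
  let v : ℕ → ℝ := fun i => i
  have hv : Set.InjOn v (Finset.range (k + 1) : Finset ℕ) := Nat.cast_injective.injOn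
  refine ⟨Lagrange.interpolate (Finset.range (k + 1)) v (fun i => σ (v i)), fun t => ?_⟩
  refine tendsto_nhds_unique (h t) ?_
  have e : ∀ n, (p n).eval t
      = ∑ i ∈ Finset.range (k + 1),
        (p n).eval (v i) * (Lagrange.basis (Finset.range (k + 1)) v i).eval t := by
    intro n
    conv_lhs => rw [Lagrange.eq_interpolate (f := p n) hv (by
      rw [Finset.card_range]
      exact lt_of_le_of_lt degree_le_natDegree (by exact_mod_cast Nat.lt_succ_of_le (hp n)))]
    simp [Lagrange.interpolate_apply, eval_finsetSum]
  simp only [e, Lagrange.interpolate_apply, eval_finsetSum, eval_mul, eval_C]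
  exact tendsto_finsetSum _ fun i _ => (h (v i)).mul_const _

/-! ### Integrals and derivatives of curves in a closed subspace -/

theorem _root_.Submodule.integral_mem_of_hasCompactSupport {X : Type*} [NormedAddCommGroup X]
    [NormedSpace ℝ X] [CompleteSpace X] {M : Submodule ℝ X} (hM : IsClosed (M : Set X))
    {F : ℝ → X} (hF : Continuous F) (hc : HasCompactSupport F) (hFM : ∀ y, F y ∈ M) :
    ∫ y, F y ∈ M := by
  have : CompleteSpace M := hM.completeSpace_coe
  let F' : ℝ → M := fun y => ⟨F y, hFM y⟩
  have hF' : Integrable F' := by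
    refine Continuous.integrable_of_hasCompactSupport (hF.subtype_mk _) ?_
    refine hc.mono fun y hy hy' => hy ?_
    exact Subtype.ext hy'
  have := M.subtypeL.integral_comp_comm hF'
  change ∫ y, F y = _ at this
  rw [this]
  exact (∫ y, F' y).2

theorem _root_.Submodule.hasDerivAt_mem {X : Type*} [NormedAddCommGroup X]
    [NormedSpace ℝ X] {M : Submodule ℝ X} (hM : IsClosed (M : Set X))
    {F : ℝ → X} (hFM : ∀ y, F y ∈ M) {s : ℝ} {v : X} (h : HasDerivAt F v s) : v ∈ M := by
  refine hM.mem_of_tendsto (hasDerivAt_iff_tendsto_slope.1 h) (Eventually.of_forall fun y => ?_)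
  exact M.smul_mem _ (M.sub_mem (hFM y) (hFM s))

/-- A curve in `C(Y, ℝ)` whose pointwise derivatives form a continuous curve is differentiable in
the sup norm, being the integral of that curve. -/
theorem _root_.ContinuousMap.hasDerivAt_of_apply {Y : Type*} [TopologicalSpace Y] [CompactSpace Y]
    {G G' : ℝ → C(Y, ℝ)} (hG' : Continuous G')
    (h : ∀ s y, HasDerivAt (fun s => G s y) (G' s y) s) (s : ℝ) : HasDerivAt G (G' s) s := by
  have e : G = fun s => G 0 + ∫ u in (0 : ℝ)..s, G' u := by
    ext s y
    have := (ContinuousMap.evalCLM ℝ y).intervalIntegral_comp_comm (hG'.intervalIntegrable 0 s)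
      (μ := volume)
    simp only [ContinuousMap.evalCLM_apply] at this
    rw [ContinuousMap.add_apply, ← this, intervalIntegral.integral_eq_sub_of_hasDerivAt
      (fun u _ => h u y)]
    · ring
    · exact ((ContinuousMap.evalCLM ℝ y).continuous.comp hG').intervalIntegrable 0 s
  rw [e]
  exact (intervalIntegral.integral_hasDerivAt_right (hG'.intervalIntegrable 0 s)
    (hG'.stronglyMeasurableAtFilter _ _) hG'.continuousAt).const_add _

/-! ### Density of the affine images of a continuous function that is not a polynomial -/

/-- The function `t ↦ g (s * t + b)` on the set `K`. -/
def affineComp (K : Set ℝ) (g : C(ℝ, ℝ)) (s b : ℝ) : C(K, ℝ) :=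
  ⟨fun t => g (s * t + b), by fun_prop⟩

/-- The closed linear span, in `C(K, ℝ)`, of the functions `t ↦ σ (s * t + b)` with `s ≠ 0`. The
scale `0` is excluded so that each generator has the antiderivative `t ↦ s⁻¹ * Ψ (s * t + b)`,
where `Ψ' = σ`. -/
def affineSpan (K : Set ℝ) [CompactSpace K] (σ : C(ℝ, ℝ)) : Submodule ℝ C(K, ℝ) :=
  (Submodule.span ℝ {g | ∃ s b : ℝ, s ≠ 0 ∧ g = affineComp K σ s b}).topologicalClosure

section

variable {K : Set ℝ} [CompactSpace K] {σ : C(ℝ, ℝ)}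

theorem affineSpan_isClosed : IsClosed (affineSpan K σ : Set C(K, ℝ)) :=
  Submodule.isClosed_topologicalClosure _

/-- The scale `s = 0` is covered as well, as a limit of nonzero scales. -/
theorem affineComp_mem (s b : ℝ) : affineComp K σ s b ∈ affineSpan K σ := by
  have hcont : Continuous fun s => affineComp K σ s b :=
    ContinuousMap.continuous_of_continuous_uncurry _ (by
      simp only [affineComp, Function.uncurry_def, ContinuousMap.coe_mk]
      fun_prop)
  have hs : Tendsto (fun n : ℕ => s + 1 / ((n : ℝ) + 1)) atTop (𝓝 s) := by
    simpa using tendsto_one_div_add_atTop_nhds_zero_nat.const_add s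
  by_cases h : s = 0
  · refine affineSpan_isClosed.mem_of_tendsto ((hcont.tendsto s).comp hs)
      (Eventually.of_forall fun n => ?_)
    refine Submodule.le_topologicalClosure _ (Submodule.subset_span ⟨_, b, ?_, rfl⟩)
    rw [h]
    positivity
  · exact Submodule.le_topologicalClosure _ (Submodule.subset_span ⟨s, b, h, rfl⟩)

/-- Affine images of a mollification of `σ` lie in the closed span of the affine images of `σ`. -/
theorem affineComp_convolution_mem {φ : ℝ → ℝ} (hφ : Continuous φ) (hc : HasCompactSupport φ)
    {η : C(ℝ, ℝ)} (hη : ∀ x, η x = ∫ y, φ y * σ (x - y)) (s b : ℝ) :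
    affineComp K η s b ∈ affineSpan K σ := by
  let F : ℝ → C(K, ℝ) := fun y => φ y • affineComp K σ s (b - y)
  have hF : Continuous F := hφ.smul (ContinuousMap.continuous_of_continuous_uncurry _ (by
      simp only [affineComp, Function.uncurry_def, ContinuousMap.coe_mk]
      fun_prop))
  have hFc : HasCompactSupport F := hc.smul_right
  have e : affineComp K η s b = ∫ y, F y := by
    ext t
    rw [ContinuousMap.integral_apply (hF.integrable_of_hasCompactSupport hFc)]
    simp only [affineComp, ContinuousMap.coe_mk, hη, F, ContinuousMap.smul_apply, smul_eq_mul,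
      add_sub_assoc]
  rw [e]
  exact Submodule.integral_mem_of_hasCompactSupport affineSpan_isClosed hF hFc
    fun y => Submodule.smul_mem _ _ (affineComp_mem _ _)

/-- A closed subspace containing `t ↦ η (s * t + b)` for all `s` contains the derivatives of all
orders in `s`. -/
theorem pow_mul_iteratedDeriv_mem {η : ℝ → ℝ} (hη : ContDiff ℝ (⊤ : ℕ∞) η)
    {M : Submodule ℝ C(K, ℝ)} (hM : IsClosed (M : Set C(K, ℝ))) (b : ℝ)
    (h : ∀ s, affineComp K ⟨η, hη.continuous⟩ s b ∈ M) (k : ℕ) (s : ℝ) (g : C(K, ℝ))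
    (hg : ∀ t : K, g t = (t : ℝ) ^ k * iteratedDeriv k η (s * t + b)) : g ∈ M := by
  have hcont : ∀ k, Continuous (iteratedDeriv k η) := fun k =>
    hη.continuous_iteratedDeriv k (by exact_mod_cast le_top)
  let G : ℕ → ℝ → C(K, ℝ) := fun k s =>
    ⟨fun t => (t : ℝ) ^ k * iteratedDeriv k η (s * t + b), by
      have := hcont k
      fun_prop⟩
  have hG : ∀ k, Continuous (G k) := fun k =>
    ContinuousMap.continuous_of_continuous_uncurry _ (by
      have := hcont k
      simp only [G, Function.uncurry_def, ContinuousMap.coe_mk]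
      fun_prop)
  suffices ∀ k s, G k s ∈ M by
    convert this k s
    ext t
    exact hg t
  clear hg g k s
  intro k
  induction k with
  | zero =>
    intro s
    convert h s using 1
    ext t
    simp [G, affineComp]
  | succ k ih =>
    intro s
    refine Submodule.hasDerivAt_mem hM ih
      (ContinuousMap.hasDerivAt_of_apply (hG (k + 1)) (fun s t => ?_) s)
    have hd : HasDerivAt (iteratedDeriv k η) (iteratedDeriv (k + 1) η (s * t + b)) (s * t + b) := by
      rw [iteratedDeriv_succ]
      exact (hη.differentiable_iteratedDeriv k (by exact_mod_cast ENat.natCast_lt_top k)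
        _).hasDerivAt
    have ha : HasDerivAt (fun s : ℝ => s * (t : ℝ) + b) (t : ℝ) s := by
      simpa using ((hasDerivAt_id s).mul_const (t : ℝ)).add_const b
    refine ((hd.comp s ha).const_mul ((t : ℝ) ^ k)).congr_deriv ?_
    simp only [G, ContinuousMap.coe_mk]
    ring

/-- Otherwise every mollification of `σ` has vanishing `k`-th derivative, hence is a polynomial of
degree at most `k`, and so is the limit `σ`. -/
theorem pow_mem_affineSpan (hσ : ¬ ∃ p : ℝ[X], ∀ t, σ t = p.eval t) (k : ℕ) (g : C(K, ℝ))
    (hg : ∀ t : K, g t = (t : ℝ) ^ k) : g ∈ affineSpan K σ := by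
  by_contra hgM
  apply hσ
  let φ : ℕ → ContDiffBump (0 : ℝ) := fun n =>
    { rIn := 1 / ((n : ℝ) + 1) / 2
      rOut := 1 / ((n : ℝ) + 1)
      rIn_pos := by positivity
      rIn_lt_rOut := half_lt_self (by positivity) }
  let η : ℕ → ℝ → ℝ := fun n => convolution ((φ n).normed volume) σ
    (ContinuousLinearMap.lsmul ℝ ℝ) volume
  have hη : ∀ n, ContDiff ℝ (⊤ : ℕ∞) (η n) := fun n =>
    (φ n).hasCompactSupport_normed.contDiff_convolution_left _ (φ n).contDiff_normed
      σ.continuous.locallyIntegrable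
  have hlim : ∀ t, Tendsto (fun n => η n t) atTop (𝓝 (σ t)) :=
    ContDiffBump.convolution_tendsto_right_of_continuous
      tendsto_one_div_add_atTop_nhds_zero_nat σ.continuous
  have hz : ∀ n b, iteratedDeriv k (η n) b = 0 := by
    intro n b
    by_contra hne
    have h1 : iteratedDeriv k (η n) b • g ∈ affineSpan K σ := by
      refine pow_mul_iteratedDeriv_mem (hη n) affineSpan_isClosed b (fun s => ?_) k 0 _ ?_
      · exact affineComp_convolution_mem (φ n).continuous_normed (φ n).hasCompactSupport_normed
          (fun x => rfl) s b
      · intro t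
        simp [hg, mul_comm]
    exact hgM ((Submodule.smul_mem_iff _ hne).1 h1)
  choose p hp hpe using fun n => exists_eq_eval_of_iteratedDeriv_eq_zero k
    ((hη n).of_le (by exact_mod_cast le_top)) (hz n)
  exact exists_eq_eval_of_tendsto k hp (fun t => by simpa only [← hpe] using hlim t)

end

/-- Affine images of a continuous function that is not a polynomial span a dense subspace of
`C([-R, R])`. -/
theorem affineSpan_eq_top (R : ℝ) {σ : C(ℝ, ℝ)} (hσ : ¬ ∃ p : ℝ[X], ∀ t, σ t = p.eval t) :
    affineSpan (Set.Icc (-R) R) σ = ⊤ := by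
  rw [eq_top_iff]
  have h := polynomialFunctions_closure_eq_top (-R) R
  intro f _
  have hf : f ∈ (polynomialFunctions (Set.Icc (-R) R)).topologicalClosure := by
    rw [h]; trivial
  refine closure_minimal ?_ affineSpan_isClosed hf
  rintro _ ⟨p, -, rfl⟩
  change Polynomial.toContinuousMapOnAlgHom _ p ∈ _
  induction p using Polynomial.induction_on' with
  | add p q hp hq =>
    rw [map_add]
    exact Submodule.add_mem _ hp hq
  | monomial n c =>
    rw [← C_mul_X_pow_eq_monomial, ← smul_eq_C_mul, map_smul]
    refine Submodule.smul_mem _ _ (pow_mem_affineSpan hσ n _ fun t => ?_)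
    simp

/-! ### One-variable approximation of the exponential with its Lipschitz constant -/

/-- On `Ω` the function `d` is bounded by `ε` and `ε`-Lipschitz. -/
def LipSmallOn {E : Type*} [SeminormedAddCommGroup E] (Ω : Set E) (ε : ℝ) (d : E → ℝ) : Prop :=
  (∀ x ∈ Ω, |d x| ≤ ε) ∧ ∀ x ∈ Ω, ∀ y ∈ Ω, |d x - d y| ≤ ε * ‖x - y‖

theorem LipSmallOn.add {E : Type*} [SeminormedAddCommGroup E] {Ω : Set E} {ε δ : ℝ} {d e : E → ℝ}
    (hd : LipSmallOn Ω ε d) (he : LipSmallOn Ω δ e) : LipSmallOn Ω (ε + δ) (d + e) := by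
  refine ⟨fun x hx => (abs_add_le _ _).trans (add_le_add (hd.1 x hx) (he.1 x hx)),
    fun x hx y hy => ?_⟩
  have := (abs_add_le (d x - d y) (e x - e y)).trans
    (add_le_add (hd.2 x hx y hy) (he.2 x hx y hy))
  rw [add_mul, Pi.add_apply, Pi.add_apply, add_sub_add_comm]
  exact this

theorem LipSmallOn.smul {E : Type*} [SeminormedAddCommGroup E] {Ω : Set E} {ε : ℝ} {d : E → ℝ}
    (hd : LipSmallOn Ω ε d) (c : ℝ) : LipSmallOn Ω (|c| * ε) (c • d) := by
  refine ⟨fun x hx => ?_, fun x hx y hy => ?_⟩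
  · rw [Pi.smul_apply, smul_eq_mul, abs_mul]
    exact mul_le_mul_of_nonneg_left (hd.1 x hx) (abs_nonneg c)
  · rw [Pi.smul_apply, Pi.smul_apply, ← smul_sub, smul_eq_mul, abs_mul, mul_assoc]
    exact mul_le_mul_of_nonneg_left (hd.2 x hx y hy) (abs_nonneg c)

theorem LipSmallOn.mono {E : Type*} [SeminormedAddCommGroup E] {Ω : Set E} {ε δ : ℝ} {d : E → ℝ}
    (hd : LipSmallOn Ω ε d) (h : ε ≤ δ) : LipSmallOn Ω δ d :=
  ⟨fun x hx => (hd.1 x hx).trans h, fun x hx y hy =>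
    (hd.2 x hx y hy).trans (mul_le_mul_of_nonneg_right h (norm_nonneg _))⟩

/-- The closure of a space of functions with respect to the norm
`max (sup norm on Ω) (Lipschitz constant on Ω)`. -/
def lipClosure {E : Type*} [SeminormedAddCommGroup E] (Ω : Set E) (V : Submodule ℝ (E → ℝ)) :
    Submodule ℝ (E → ℝ) where
  carrier := {f | ∀ ε > 0, ∃ g ∈ V, LipSmallOn Ω ε (f - g)}
  zero_mem' := fun ε hε => ⟨0, V.zero_mem, by simp [hε.le], fun x _ y _ => by
    simpa using mul_nonneg hε.le (norm_nonneg _)⟩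
  add_mem' := by
    intro f f' hf hf' ε hε
    obtain ⟨g, hg, h⟩ := hf (ε / 2) (half_pos hε)
    obtain ⟨g', hg', h'⟩ := hf' (ε / 2) (half_pos hε)
    refine ⟨g + g', V.add_mem hg hg', ?_⟩
    have := h.add h'
    rwa [add_halves, sub_add_sub_comm] at this
  smul_mem' := by
    intro c f hf ε hε
    obtain ⟨g, hg, h⟩ := hf (ε / (|c| + 1)) (by positivity)
    refine ⟨c • g, V.smul_mem c hg, ?_⟩
    rw [← smul_sub]
    refine (h.smul c).mono ?_
    rw [mul_div_assoc', div_le_iff₀ (by positivity)]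
    nlinarith [abs_nonneg c]

/-- The linear span of the functions `t ↦ ψ (s * t - b)` of one variable. -/
def ridgeSpan₁ (ψ : ℝ → ℝ) : Submodule ℝ (ℝ → ℝ) :=
  Submodule.span ℝ (Set.range fun p : ℝ × ℝ => fun t => ψ (p.1 * t - p.2))

theorem mem_ridgeSpan₁ (ψ : ℝ → ℝ) (s b : ℝ) : (fun t => ψ (s * t - b)) ∈ ridgeSpan₁ ψ :=
  Submodule.subset_span ⟨(s, b), rfl⟩

theorem const_mem_ridgeSpan₁ {ψ : ℝ → ℝ} {b : ℝ} (hb : ψ b ≠ 0) (c : ℝ) :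
    (fun _ => c) ∈ ridgeSpan₁ ψ := by
  convert (ridgeSpan₁ ψ).smul_mem (c / ψ b) (mem_ridgeSpan₁ ψ 0 (-b)) using 1
  ext t
  simp [hb]

/-- Uniform approximation of the right derivative suffices for approximation in the norm of
`lipClosure`, provided the approximating space contains the constants. -/
theorem mem_lipClosure_of_hasDerivWithinAt {R : ℝ} (hR : 0 ≤ R) {V : Submodule ℝ (ℝ → ℝ)}
    (hV : ∀ c : ℝ, (fun _ => c) ∈ V) {f : ℝ → ℝ}
    (h : ∀ ε > 0, ∃ g ∈ V, ContinuousOn (f - g) (Set.Icc (-R) R) ∧ ∃ d' : ℝ → ℝ,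
      ∀ t ∈ Set.Ico (-R) R, HasDerivWithinAt (f - g) (d' t) (Set.Ici t) t ∧ |d' t| ≤ ε) :
    f ∈ lipClosure (Set.Icc (-R) R) V := by
  intro ε hε
  obtain ⟨g, hg, hc, d', hd⟩ := h (ε / (2 * R + 1)) (by positivity)
  set δ := ε / (2 * R + 1) with hδ
  have hδ0 : 0 ≤ δ := by positivity
  have hδε : δ * (2 * R + 1) = ε := div_mul_cancel₀ _ (by positivity)
  have key : ∀ x ∈ Set.Icc (-R) R, ∀ y ∈ Set.Icc (-R) R, x ≤ y →
      |(f - g) y - (f - g) x| ≤ δ * (y - x) := by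
    intro x hx y hy hxy
    exact norm_image_sub_le_of_norm_deriv_right_le_segment (f := f - g) (f' := d')
      (hc.mono (Set.Icc_subset_Icc hx.1 hy.2))
      (fun t ht => (hd t ⟨hx.1.trans ht.1, ht.2.trans_le hy.2⟩).1)
      (fun t ht => (hd t ⟨hx.1.trans ht.1, ht.2.trans_le hy.2⟩).2) y ⟨hxy, le_rfl⟩
  have hlip : ∀ x ∈ Set.Icc (-R) R, ∀ y ∈ Set.Icc (-R) R,
      |(f - g) x - (f - g) y| ≤ δ * |x - y| := by
    intro x hx y hy
    rcases le_total x y with hxy | hxy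
    · rw [abs_sub_comm, abs_sub_comm x, abs_of_nonneg (sub_nonneg.2 hxy)]
      exact key x hx y hy hxy
    · rw [abs_of_nonneg (sub_nonneg.2 hxy)]
      exact key y hy x hx hxy
  refine ⟨g + fun _ => (f - g) (-R), V.add_mem hg (hV _), fun x hx => ?_, fun x hx y hy => ?_⟩
  · have := key (-R) ⟨le_rfl, by linarith⟩ x hx hx.1
    have h2 : δ * (x - -R) ≤ ε := by
      rw [← hδε]
      exact mul_le_mul_of_nonneg_left (by linarith [hx.2]) hδ0
    refine le_trans (le_of_eq ?_) (this.trans h2)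
    simp only [Pi.sub_apply, Pi.add_apply]
    ring_nf
  · have := hlip x hx y hy
    have h2 : δ * |x - y| ≤ ε * |x - y| := by
      refine mul_le_mul_of_nonneg_right ?_ (abs_nonneg _)
      rw [← hδε]
      nlinarith
    refine le_trans (le_of_eq ?_) (this.trans h2)
    simp only [Pi.sub_apply, Pi.add_apply]
    ring_nf

theorem exp_mem_lipClosure_of_contDiff {R : ℝ} (hR : 0 ≤ R) {ψ : ℝ → ℝ} (hψ : ContDiff ℝ 1 ψ)
    (hp : ¬ ∃ p : ℝ[X], ∀ t, ψ t = p.eval t) :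
    Real.exp ∈ lipClosure (Set.Icc (-R) R) (ridgeSpan₁ ψ) := by
  obtain ⟨b, hb⟩ : ∃ b, ψ b ≠ 0 := by
    by_contra! h
    exact hp ⟨0, by simpa using h⟩
  let σ : C(ℝ, ℝ) := ⟨deriv ψ, hψ.continuous_deriv le_rfl⟩
  have hσ : ¬ ∃ p : ℝ[X], ∀ t, σ t = p.eval t := by
    rintro ⟨q, hq⟩
    obtain ⟨p, -, h⟩ := exists_eq_eval_of_deriv_eq_eval (hψ.differentiable one_ne_zero) hq
    exact hp ⟨p, h⟩
  -- Each combination of the `ψ' (s * t + b)` with `s ≠ 0` is the derivative of one of the `ψ`.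
  have hprim : ∀ g ∈ Submodule.span ℝ
      {g | ∃ s b : ℝ, s ≠ 0 ∧ g = affineComp (Set.Icc (-R) R) σ s b},
      ∃ G ∈ ridgeSpan₁ ψ, ∃ G' : ℝ → ℝ, (∀ t, HasDerivAt G (G' t) t) ∧
        ∀ t : Set.Icc (-R) R, g t = G' t := by
    intro g hg
    induction hg using Submodule.span_induction with
    | mem g hg =>
      obtain ⟨s, b, hs, rfl⟩ := hg
      refine ⟨_, (ridgeSpan₁ ψ).smul_mem s⁻¹ (mem_ridgeSpan₁ ψ s (-b)),
        fun t => σ (s * t + b), fun t => ?_, fun t => rfl⟩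
      have h1 : HasDerivAt ψ (σ (s * t - -b)) (s * t - -b) :=
        (hψ.differentiable one_ne_zero _).hasDerivAt
      have h2 : HasDerivAt (fun t : ℝ => s * t - -b) s t := by
        simpa using ((hasDerivAt_id t).const_mul s).sub_const (-b)
      refine ((h1.comp t h2).const_smul s⁻¹).congr_deriv ?_
      rw [sub_neg_eq_add, smul_eq_mul]
      field_simp
    | zero => exact ⟨0, Submodule.zero_mem _, 0, fun t => hasDerivAt_const t 0, fun t => rfl⟩
    | add g₁ g₂ _ _ h₁ h₂ =>
      obtain ⟨G₁, m₁, G₁', d₁, e₁⟩ := h₁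
      obtain ⟨G₂, m₂, G₂', d₂, e₂⟩ := h₂
      exact ⟨G₁ + G₂, Submodule.add_mem _ m₁ m₂, G₁' + G₂', fun t => (d₁ t).add (d₂ t),
        fun t => by simp [e₁, e₂]⟩
    | smul c g _ h =>
      obtain ⟨G, m, G', d, e⟩ := h
      exact ⟨c • G, Submodule.smul_mem _ _ m, c • G', fun t => (d t).const_smul c,
        fun t => by simp [e]⟩
  refine mem_lipClosure_of_hasDerivWithinAt hR (const_mem_ridgeSpan₁ hb) fun ε hε => ?_
  let e : C(Set.Icc (-R) R, ℝ) := ⟨fun t => Real.exp t, by fun_prop⟩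
  have he : e ∈ affineSpan (Set.Icc (-R) R) σ := by
    rw [affineSpan_eq_top R hσ]
    trivial
  obtain ⟨g, hg, hge⟩ := Metric.mem_closure_iff.1 he ε hε
  obtain ⟨G, hG, G', hd, hGg⟩ := hprim g hg
  have hd' : ∀ t, HasDerivAt (Real.exp - G) (Real.exp t - G' t) t := fun t =>
    (Real.hasDerivAt_exp t).sub (hd t)
  refine ⟨G, hG, fun t _ => (hd' t).continuousAt.continuousWithinAt, fun t => Real.exp t - G' t,
    fun t ht => ⟨(hd' t).hasDerivWithinAt, ?_⟩⟩
  have := (ContinuousMap.dist_apply_le_dist (f := e) (g := g) ⟨t, ht.1, ht.2.le⟩).trans hge.le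
  rwa [hGg, Real.dist_eq] at this

theorem hasDerivWithinAt_relu_sub (s t : ℝ) :
    HasDerivWithinAt (fun t => relu (1 * t - s)) (if s ≤ t then 1 else 0) (Set.Ici t) t := by
  split_ifs with h
  · refine HasDerivWithinAt.congr (f := fun t => t - s)
      ((hasDerivAt_id t).sub_const s).hasDerivWithinAt (fun x hx => ?_) ?_
    · rw [relu, one_mul, max_eq_left (by linarith [Set.mem_Ici.1 hx])]
    · rw [relu, one_mul, max_eq_left (by linarith)]
  · refine ((hasDerivAt_const t (0 : ℝ)).congr_of_eventuallyEq ?_).hasDerivWithinAt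
    filter_upwards [eventually_lt_nhds (not_le.1 h)] with x hx
    rw [relu, one_mul, max_eq_right (by linarith)]

theorem exp_mem_lipClosure_relu {R : ℝ} (hR : 0 ≤ R) :
    Real.exp ∈ lipClosure (Set.Icc (-R) R) (ridgeSpan₁ relu) := by
  refine mem_lipClosure_of_hasDerivWithinAt hR
    (const_mem_ridgeSpan₁ (b := 1) (by norm_num [relu])) fun ε hε => ?_
  set δ := ε * Real.exp (-R) with hδ
  have hδ0 : 0 < δ := by positivity
  -- the nodes of a piecewise linear interpolation, with mesh `δ`
  let s : ℕ → ℝ := fun k => -R + k * δ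
  let N := ⌊(R + R) / δ⌋₊
  let r : ℝ → ℝ → ℝ := fun s t => relu (1 * t - s)
  let g : ℝ → ℝ := Real.exp (s 0) • r (s 0) +
    ∑ k ∈ Finset.range N, (Real.exp (s (k + 1)) - Real.exp (s k)) • r (s (k + 1))
  let g' : ℝ → ℝ := fun t => Real.exp (s 0) • (if s 0 ≤ t then 1 else 0) +
    ∑ k ∈ Finset.range N, (Real.exp (s (k + 1)) - Real.exp (s k)) • (if s (k + 1) ≤ t then 1 else 0)
  have hg : g ∈ ridgeSpan₁ relu := by
    refine Submodule.add_mem _ (Submodule.smul_mem _ _ (mem_ridgeSpan₁ _ _ _))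
      (Submodule.sum_mem _ fun k _ => Submodule.smul_mem _ _ (mem_ridgeSpan₁ _ _ _))
  have hgd : ∀ t, HasDerivWithinAt g (g' t) (Set.Ici t) t := fun t =>
    ((hasDerivWithinAt_relu_sub _ t).const_smul _).add
      (HasDerivWithinAt.sum fun k _ => (hasDerivWithinAt_relu_sub _ t).const_smul _)
  have hgc : Continuous g := by
    have : ∀ s, Continuous (r s) := fun s => by
      simp only [r, relu]
      fun_prop
    refine ((this _).const_smul _).add ?_
    rw [Finset.sum_fn]
    exact continuous_finsetSum _ fun k _ => (this _).const_smul _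
  refine ⟨g, hg, (Real.continuous_exp.sub hgc).continuousOn, fun t => Real.exp t - g' t,
    fun t ht => ⟨(Real.hasDerivAt_exp t).hasDerivWithinAt.sub (hgd t), ?_⟩⟩
  have ht0 : 0 ≤ t + R := by linarith [ht.1]
  let m := ⌊(t + R) / δ⌋₊
  have hm1 : m * δ ≤ t + R := (le_div_iff₀ hδ0).1 (Nat.floor_le (by positivity))
  have hm2 : t + R < (m + 1) * δ := (div_lt_iff₀ hδ0).1 (Nat.lt_floor_add_one _)
  have hmN : m ≤ N := Nat.floor_le_floor (by gcongr; exact ht.2.le)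
  have hs : ∀ k, s k ≤ t ↔ k ≤ m := by
    intro k
    rw [Nat.le_floor_iff (by positivity), le_div_iff₀ hδ0]
    simp only [s]
    constructor <;> intro h <;> linarith
  -- the slope at `t` telescopes to the value of `exp` at the last node before `t`
  have hg't : g' t = Real.exp (s m) := by
    have h0 : s 0 ≤ t := (hs 0).2 (Nat.zero_le _)
    have hsum : ∑ k ∈ Finset.range N, (Real.exp (s (k + 1)) - Real.exp (s k)) •
        (if s (k + 1) ≤ t then (1 : ℝ) else 0) =
        ∑ k ∈ Finset.range m, (Real.exp (s (k + 1)) - Real.exp (s k)) := by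
      rw [← Finset.sum_subset (Finset.range_mono hmN)]
      · refine Finset.sum_congr rfl fun k hk => ?_
        rw [if_pos ((hs _).2 (Finset.mem_range.1 hk)), smul_eq_mul, mul_one]
      · intro k _ hk
        rw [if_neg, smul_zero]
        rw [hs]
        simpa using hk
    simp only [g']
    rw [hsum, Finset.sum_range_sub (fun k => Real.exp (s k)), if_pos h0, smul_eq_mul, mul_one]
    ring
  change |Real.exp t - g' t| ≤ ε
  rw [hg't]
  have hsm : s m ≤ t := (hs m).2 le_rfl
  have hexp : Real.exp (s m) = Real.exp t * Real.exp (s m - t) := by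
    rw [← Real.exp_add]
    ring_nf
  have h1 : 1 - Real.exp (s m - t) ≤ δ := by
    have := Real.add_one_le_exp (s m - t)
    simp only [s] at this ⊢
    linarith
  rw [abs_of_nonneg (sub_nonneg.2 (Real.exp_le_exp.2 hsm)), hexp]
  calc Real.exp t - Real.exp t * Real.exp (s m - t)
      = Real.exp t * (1 - Real.exp (s m - t)) := by ring
    _ ≤ Real.exp t * δ := mul_le_mul_of_nonneg_left h1 (Real.exp_nonneg _)
    _ ≤ Real.exp R * δ := mul_le_mul_of_nonneg_right (Real.exp_le_exp.2 ht.2.le) hδ0.le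
    _ = ε := by rw [hδ, mul_left_comm, ← Real.exp_add, add_neg_cancel, Real.exp_zero, mul_one]

theorem exp_mem_lipClosure {R : ℝ} (hR : 0 ≤ R) {ψ : ℝ → ℝ} (hψ : AdmissibleActivation ψ) :
    Real.exp ∈ lipClosure (Set.Icc (-R) R) (ridgeSpan₁ ψ) := by
  rcases hψ with rfl | ⟨hψ, hp⟩
  · exact exp_mem_lipClosure_relu hR
  · exact exp_mem_lipClosure_of_contDiff hR hψ hp

/-! ### Combinations of exponentials -/

section

variable {ι : Type*} [Fintype ι]

/-- The linear span of the exponentials `x ↦ exp ⟪w, x⟫`. -/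
def expSpan (ι : Type*) [Fintype ι] : Submodule ℝ (EuclideanSpace ℝ ι → ℝ) :=
  Submodule.span ℝ (Set.range fun w x => Real.exp (inner ℝ w x))

theorem exp_mem_expSpan (w : EuclideanSpace ℝ ι) :
    (fun x => Real.exp (inner ℝ w x)) ∈ expSpan ι :=
  Submodule.subset_span ⟨w, rfl⟩

theorem const_mem_expSpan (c : ℝ) : (fun _ => c) ∈ expSpan ι := by
  convert (expSpan ι).smul_mem c (exp_mem_expSpan 0) using 1
  ext x
  simp

theorem mul_mem_expSpan {p q : EuclideanSpace ℝ ι → ℝ} (hp : p ∈ expSpan ι)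
    (hq : q ∈ expSpan ι) : p * q ∈ expSpan ι := by
  have h := Submodule.mul_mem_mul hp hq
  rw [expSpan, Submodule.span_mul_span] at h
  refine Submodule.span_mono ?_ h
  rintro _ ⟨_, ⟨w, rfl⟩, _, ⟨w', rfl⟩, rfl⟩
  refine ⟨w + w', funext fun x => ?_⟩
  simp [inner_add_left, Real.exp_add]

theorem pow_mem_expSpan {p : EuclideanSpace ℝ ι → ℝ} (hp : p ∈ expSpan ι) (n : ℕ) :
    p ^ n ∈ expSpan ι := by
  induction n with
  | zero => exact const_mem_expSpan 1
  | succ n ih => exact pow_succ p n ▸ mul_mem_expSpan ih hp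

theorem continuous_of_mem_expSpan {p : EuclideanSpace ℝ ι → ℝ} (hp : p ∈ expSpan ι) :
    Continuous p := by
  induction hp using Submodule.span_induction with
  | mem p hp =>
    obtain ⟨w, rfl⟩ := hp
    fun_prop
  | zero => exact continuous_zero
  | add p q _ _ hp hq => exact hp.add hq
  | smul c p _ hp => exact hp.const_smul c

/-- Convolution with a compactly supported function maps the span of exponentials to itself. -/
theorem integral_sub_mul_mem_expSpan {p : EuclideanSpace ℝ ι → ℝ} (hp : p ∈ expSpan ι)
    {u : EuclideanSpace ℝ ι → ℝ} (hu : Continuous u) (hc : HasCompactSupport u) :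
    (fun x => ∫ y, p (x - y) * u y) ∈ expSpan ι := by
  have hint : ∀ q ∈ expSpan ι, ∀ x, Integrable fun y => q (x - y) * u y := fun q hq x =>
    (((continuous_of_mem_expSpan hq).comp (continuous_sub_left x)).mul
      hu).integrable_of_hasCompactSupport hc.mul_left
  induction hp using Submodule.span_induction with
  | mem p hp =>
    obtain ⟨w, rfl⟩ := hp
    convert (expSpan ι).smul_mem (∫ y, Real.exp (-inner ℝ w y) * u y) (exp_mem_expSpan w) using 1
    ext x
    rw [Pi.smul_apply, smul_eq_mul, ← integral_mul_const]
    refine integral_congr_ae (Eventually.of_forall fun y => ?_)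
    beta_reduce
    rw [inner_sub_right, sub_eq_add_neg, Real.exp_add]
    ring
  | zero =>
    simp only [Pi.zero_apply, zero_mul, integral_zero]
    exact (expSpan ι).zero_mem
  | add p q hp hq ihp ihq =>
    convert (expSpan ι).add_mem ihp ihq using 1
    ext x
    rw [Pi.add_apply, ← integral_add (hint p hp x) (hint q hq x)]
    simp only [Pi.add_apply, add_mul]
  | smul c p _ ihp =>
    convert (expSpan ι).smul_mem c ihp using 1
    ext x
    rw [Pi.smul_apply, smul_eq_mul, ← integral_const_mul]
    simp only [Pi.smul_apply, smul_eq_mul, mul_assoc]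

/-- A combination of exponentials that is positive on the ball of radius `R` and attains its
maximum only at the origin. -/
noncomputable def coshPeak (ι : Type*) [Fintype ι] (R : ℝ) (t : EuclideanSpace ℝ ι) : ℝ :=
  (Fintype.card ι * Real.cosh R + 1) - ∑ j, Real.cosh (t j)

theorem coshPeak_mem_expSpan (R : ℝ) : coshPeak ι R ∈ expSpan ι := by
  classical
  have h : ∀ j, (fun t : EuclideanSpace ℝ ι => Real.cosh (t j)) ∈ expSpan ι := by
    intro j
    convert (expSpan ι).smul_mem (1 / 2) ((expSpan ι).add_mem
      (exp_mem_expSpan (EuclideanSpace.single j 1))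
      (exp_mem_expSpan (EuclideanSpace.single j (-1)))) using 1
    ext t
    simp only [Pi.smul_apply, Pi.add_apply, EuclideanSpace.inner_single_left, Real.cosh_eq]
    simp
    ring
  have := (expSpan ι).sub_mem (const_mem_expSpan (Fintype.card ι * Real.cosh R + 1))
    ((expSpan ι).sum_mem fun j (_ : j ∈ Finset.univ) => h j)
  convert this using 1
  ext t
  simp [coshPeak]

theorem one_le_coshPeak {R : ℝ} {t : EuclideanSpace ℝ ι} (ht : ‖t‖ ≤ R) : 1 ≤ coshPeak ι R t := by
  have h : ∑ j, Real.cosh (t j) ≤ ∑ _j : ι, Real.cosh R := Finset.sum_le_sum fun j _ => by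
    rw [Real.cosh_le_cosh, abs_of_nonneg ((norm_nonneg t).trans ht)]
    exact (PiLp.norm_apply_le t j).trans ht
  rw [Finset.sum_const, Finset.card_univ, nsmul_eq_mul] at h
  rw [coshPeak]
  linarith

theorem coshPeak_lt_coshPeak_zero (R : ℝ) {t : EuclideanSpace ℝ ι} (ht : t ≠ 0) :
    coshPeak ι R t < coshPeak ι R 0 := by
  obtain ⟨j, hj⟩ : ∃ j, t j ≠ 0 := by
    by_contra! h
    exact ht (PiLp.ext h)
  refine sub_lt_sub_left (Finset.sum_lt_sum (fun j _ => ?_) ⟨j, Finset.mem_univ j, ?_⟩) _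
  · simp
  · simpa using Real.one_lt_cosh.2 hj

/-- A bounded Lipschitz function on a bounded set extends to the whole space with the same
Lipschitz constant, the same bound, and with bounded support. -/
theorem exists_lipschitz_extension {E : Type*} [NormedAddCommGroup E] {Ω : Set E} {ρ : ℝ}
    (hΩ : ∀ x ∈ Ω, ‖x‖ ≤ ρ) {u : E → ℝ} {L : ℝ≥0} (hL : 0 < L) {B : ℝ} (hB : 0 ≤ B)
    (hu : LipschitzOnWith L u Ω) (hub : ∀ x ∈ Ω, |u x| ≤ B) :
    ∃ v : E → ℝ, LipschitzWith L v ∧ (∀ x, |v x| ≤ B) ∧ Set.EqOn v u Ω ∧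
      ∀ x, ρ + B / L < ‖x‖ → v x = 0 := by
  obtain ⟨w, hw, hwu⟩ := hu.extend_real
  -- Truncate at a cone-shaped level `h` of slope `L`, equal to `B` on the ball of radius `ρ`.
  let h : E → ℝ := fun x => min B (max 0 (B + L * ρ - L * ‖x‖))
  have h0 : ∀ x, 0 ≤ h x := fun x => le_min hB (le_max_left _ _)
  have hh : LipschitzWith L h := by
    refine LipschitzWith.const_min (LipschitzWith.const_max ?_ _) _
    refine LipschitzWith.of_dist_le_mul fun x y => ?_
    rw [Real.dist_eq, dist_eq_norm, sub_sub_sub_cancel_left, ← mul_sub, abs_mul,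
      NNReal.abs_eq, abs_sub_comm]
    exact mul_le_mul_of_nonneg_left (abs_norm_sub_norm_le x y) L.coe_nonneg
  refine ⟨fun x => max (-h x) (min (h x) (w x)), ?_, fun x => ?_, fun x hx => ?_, fun x hx => ?_⟩
  · have := hh.neg.max (hh.min hw)
    rwa [max_self, max_self] at this
  · have hB' : h x ≤ B := min_le_left _ _
    rw [abs_le]
    exact ⟨le_max_of_le_left (neg_le_neg hB'),
      max_le (by linarith [h0 x]) ((min_le_left _ _).trans hB')⟩
  · have hx' : h x = B := by
      have : (L : ℝ) * ‖x‖ ≤ L * ρ := mul_le_mul_of_nonneg_left (hΩ x hx) L.coe_nonneg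
      exact min_eq_left (le_max_of_le_right (by linarith))
    have hb := abs_le.1 (hub x hx)
    rw [hwu hx] at hb ⊢
    simp only [hx']
    rw [min_eq_right hb.2, max_eq_right hb.1]
  · have hx' : h x = 0 := by
      have hL' : (0 : ℝ) < L := hL
      have : L * (ρ + B / L) < L * ‖x‖ := mul_lt_mul_of_pos_left hx hL'
      rw [mul_add, mul_div_cancel₀ _ hL'.ne'] at this
      simp only [h]
      rw [max_eq_left (by linarith), min_eq_right hB]
    simp [hx']

/-- A bounded Lipschitz function on a bounded set is a uniform limit of combinations of
exponentials with the same Lipschitz constant and the same bound. -/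
theorem exists_mem_expSpan_approx {Ω : Set (EuclideanSpace ℝ ι)} {ρ : ℝ} (hρ : 0 ≤ ρ)
    (hΩ : ∀ x ∈ Ω, ‖x‖ ≤ ρ) {u : EuclideanSpace ℝ ι → ℝ} {L : ℝ≥0} (hL : 0 < L) {B : ℝ}
    (hB : 0 ≤ B) (hu : LipschitzOnWith L u Ω) (hub : ∀ x ∈ Ω, |u x| ≤ B) {δ : ℝ} (hδ : 0 < δ) :
    ∃ v ∈ expSpan ι, LipschitzOnWith L v Ω ∧ (∀ x ∈ Ω, |v x| ≤ B) ∧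
      ∀ x ∈ Ω, |v x - u x| ≤ δ := by
  obtain ⟨f, hf, hfB, hfu, hf0⟩ := exists_lipschitz_extension hΩ hL hB hu hub
  have hfc : HasCompactSupport f := by
    refine HasCompactSupport.intro (isCompact_closedBall 0 (ρ + B / L)) fun x hx => hf0 x ?_
    simpa using hx
  let R := ρ + (ρ + B / L) + 1
  have hR : 0 < R := by positivity
  let s := Metric.closedBall (0 : EuclideanSpace ℝ ι) R
  have hs : IsCompact s := isCompact_closedBall 0 R
  have hsm : MeasurableSet s := hs.measurableSet
  let κ : EuclideanSpace ℝ ι → ℝ := coshPeak ι R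
  have hκc : Continuous κ := continuous_of_mem_expSpan (coshPeak_mem_expSpan R)
  have hκ1 : ∀ t ∈ s, 1 ≤ κ t := fun t ht => one_le_coshPeak (by simpa [s] using ht)
  have hint : ∀ n : ℕ, ∀ g : EuclideanSpace ℝ ι → ℝ, Continuous g →
      IntegrableOn (fun t => κ t ^ n * g t) s := fun n g hg =>
    ((hκc.pow n).mul hg).continuousOn.integrableOn_compact hs
  have hZ : ∀ n : ℕ, 0 < ∫ t in s, κ t ^ n := by
    intro n
    have h1 : ∫ _t in s, (1 : ℝ) ≤ ∫ t in s, κ t ^ n :=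
      setIntegral_mono_on (integrableOn_const hs.measure_lt_top.ne)
        ((hκc.pow n).continuousOn.integrableOn_compact hs) hsm
        fun t ht => one_le_pow₀ (hκ1 t ht)
    refine lt_of_lt_of_le ?_ h1
    rw [setIntegral_const, smul_eq_mul, mul_one]
    exact ENNReal.toReal_pos (Metric.measure_closedBall_pos volume _ hR).ne' hs.measure_lt_top.ne
  -- `A n g` is the average of `g` over the ball with the weight `κ ^ n`.
  let A : ℕ → (EuclideanSpace ℝ ι → ℝ) → ℝ := fun n g =>
    (∫ t in s, κ t ^ n)⁻¹ * ∫ t in s, κ t ^ n * g t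
  have hA : ∀ n (g g' : EuclideanSpace ℝ ι → ℝ), Continuous g' → (∀ t ∈ s, |g t| ≤ g' t) →
      |A n g| ≤ A n g' := by
    intro n g g' hg' h
    simp only [A]
    rw [abs_mul, abs_of_pos (inv_pos.2 (hZ n))]
    refine mul_le_mul_of_nonneg_left ?_ (inv_pos.2 (hZ n)).le
    rw [← Real.norm_eq_abs]
    refine norm_integral_le_of_norm_le (hint n g' hg') ?_
    refine (ae_restrict_iff' hsm).2 (Eventually.of_forall fun t ht => ?_)
    have hk : 0 ≤ κ t ^ n := pow_nonneg (zero_le_one.trans (hκ1 t ht)) n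
    rw [Real.norm_eq_abs, abs_mul, abs_of_nonneg hk]
    exact mul_le_mul_of_nonneg_left (h t ht) hk
  have hAc : ∀ n (c : ℝ), A n (fun _ => c) = c := by
    intro n c
    simp only [A]
    rw [integral_mul_const, inv_mul_cancel_left₀ (hZ n).ne']
  have hAs : ∀ n (g g' : EuclideanSpace ℝ ι → ℝ), Continuous g → Continuous g' →
      A n g - A n g' = A n fun t => g t - g' t := by
    intro n g g' hg hg'
    simp only [A]
    rw [← mul_sub, ← integral_sub (hint n g hg) (hint n g' hg')]
    simp only [mul_sub]
  have hfx : ∀ x, Continuous fun t => f (x - t) := fun x =>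
    hf.continuous.comp (continuous_sub_left x)
  have hlim : Tendsto (fun n => A n fun t => L * ‖t‖) atTop (𝓝 0) := by
    have := tendsto_setIntegral_pow_smul_of_unique_maximum_of_isCompact_of_continuousOn
      (μ := volume) hs hκc.continuousOn (x₀ := 0)
      (fun y _ hy => coshPeak_lt_coshPeak_zero R hy) (fun t ht => zero_le_one.trans (hκ1 t ht))
      (zero_lt_one.trans_le (hκ1 0 (by simp [s, hR.le])))
      (subset_closure (Metric.ball_subset_interior_closedBall (Metric.mem_ball_self hR)))
      (g := fun t => L * ‖t‖) (by fun_prop)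
    simpa using this
  obtain ⟨n, hn⟩ := (hlim.eventually_lt_const hδ).exists
  have hAv : ∀ x ∈ Ω, (∫ t in s, κ t ^ n)⁻¹ * ∫ y, κ (x - y) ^ n * f y = A n fun t => f (x - t) := by
    intro x hx
    simp only [A]
    congr 1
    rw [setIntegral_eq_integral_of_forall_compl_eq_zero,
      ← integral_sub_left_eq_self (fun y => κ (x - y) ^ n * f y) volume x]
    · simp only [sub_sub_cancel]
    · intro t ht
      rw [hf0, mul_zero]
      have h1 : R < ‖t‖ := by simpa [s] using ht
      have h2 : ‖t‖ - ‖x‖ ≤ ‖x - t‖ := by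
        rw [norm_sub_rev]
        exact norm_sub_norm_le t x
      have := hΩ x hx
      simp only [R] at h1
      linarith
  refine ⟨fun x => (∫ t in s, κ t ^ n)⁻¹ * ∫ y, κ (x - y) ^ n * f y,
    (expSpan ι).smul_mem _ (integral_sub_mul_mem_expSpan
      (pow_mem_expSpan (coshPeak_mem_expSpan R) n) hf.continuous hfc),
    LipschitzOnWith.of_dist_le_mul fun x hx y hy => ?_, fun x hx => ?_, fun x hx => ?_⟩
  · beta_reduce
    rw [hAv x hx, hAv y hy, Real.dist_eq, hAs n _ _ (hfx x) (hfx y), ← hAc n (L * dist x y)]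
    refine hA n _ _ continuous_const fun t _ => ?_
    rw [← Real.dist_eq, ← dist_sub_right x y t]
    exact hf.dist_le_mul _ _
  · beta_reduce
    rw [hAv x hx, ← hAc n B]
    exact hA n _ _ continuous_const fun t _ => hfB _
  · beta_reduce
    rw [hAv x hx, ← hfu hx, ← hAc n (f x), hAs n _ _ (hfx x) continuous_const]
    refine (hA n _ (fun t => L * ‖t‖) (by fun_prop) fun t _ => ?_).trans hn.le
    have := hf.dist_le_mul (x - t) x
    rwa [dist_eq_norm (x - t) x, sub_sub_cancel_left, norm_neg] at this

end

/-! ### Ridge networks -/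

section

variable {ι : Type*} [Fintype ι]

/-- The linear span of the ridgelet functions, i.e. the scalar-valued ridge networks. -/
def ridgeSpan (ι : Type*) [Fintype ι] (ψ : ℝ → ℝ) : Submodule ℝ (EuclideanSpace ℝ ι → ℝ) :=
  Submodule.span ℝ (Set.range fun p : EuclideanSpace ℝ ι × ℝ => ridgelet ψ p.1 p.2)

theorem comp_inner_mem_ridgeSpan {ψ : ℝ → ℝ} {g : ℝ → ℝ} (hg : g ∈ ridgeSpan₁ ψ)
    (w : EuclideanSpace ℝ ι) : (fun x => g (inner ℝ w x)) ∈ ridgeSpan ι ψ := by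
  have h : ridgeSpan₁ ψ ≤ (ridgeSpan ι ψ).comap
      (LinearMap.funLeft ℝ ℝ fun x : EuclideanSpace ℝ ι => (inner ℝ w x : ℝ)) := by
    refine Submodule.span_le.2 ?_
    rintro _ ⟨⟨s, b⟩, rfl⟩
    refine Submodule.subset_span ⟨(s • w, b), funext fun x => ?_⟩
    simp [ridgelet, LinearMap.funLeft_apply, real_inner_smul_left]
  exact h hg

theorem expSpan_le_lipClosure {ψ : ℝ → ℝ} (hψ : AdmissibleActivation ψ)
    {Ω : Set (EuclideanSpace ℝ ι)} {ρ : ℝ} (hρ : 0 ≤ ρ) (hΩ : ∀ x ∈ Ω, ‖x‖ ≤ ρ) :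
    expSpan ι ≤ lipClosure Ω (ridgeSpan ι ψ) := by
  refine Submodule.span_le.2 ?_
  rintro _ ⟨w, rfl⟩ ε hε
  obtain ⟨g, hg, h⟩ := exp_mem_lipClosure (R := ‖w‖ * ρ) (by positivity) hψ
    (ε / (‖w‖ + 1)) (by positivity)
  have hw : ∀ x ∈ Ω, inner ℝ w x ∈ Set.Icc (-(‖w‖ * ρ)) (‖w‖ * ρ) := fun x hx =>
    abs_le.1 ((abs_real_inner_le_norm w x).trans
      (mul_le_mul_of_nonneg_left (hΩ x hx) (norm_nonneg w)))
  have hle : ε / (‖w‖ + 1) * ‖w‖ ≤ ε := by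
    rw [div_mul_eq_mul_div, div_le_iff₀ (by positivity)]
    nlinarith [norm_nonneg w]
  refine ⟨_, comp_inner_mem_ridgeSpan hg w, fun x hx => (h.1 _ (hw x hx)).trans ?_,
    fun x hx y hy => (h.2 _ (hw x hx) _ (hw y hy)).trans ?_⟩
  · exact div_le_self hε.le (by linarith [norm_nonneg w])
  · calc ε / (‖w‖ + 1) * ‖inner ℝ w x - inner ℝ w y‖
        ≤ ε / (‖w‖ + 1) * (‖w‖ * ‖x - y‖) := by
          rw [← inner_sub_right]
          exact mul_le_mul_of_nonneg_left (norm_inner_le_norm _ _) (by positivity)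
      _ ≤ ε * ‖x - y‖ := by
          rw [← mul_assoc]
          exact mul_le_mul_of_nonneg_right hle (norm_nonneg _)

/-- Scalar ridge networks obeying the same Lipschitz constant and the same bound as `u`
approximate `u` uniformly. -/
theorem exists_mem_ridgeSpan_approx {ψ : ℝ → ℝ} (hψ : AdmissibleActivation ψ)
    {Ω : Set (EuclideanSpace ℝ ι)} {ρ : ℝ} (hρ : 0 ≤ ρ) (hΩ : ∀ x ∈ Ω, ‖x‖ ≤ ρ)
    {u : EuclideanSpace ℝ ι → ℝ} {L : ℝ≥0} (hL : 0 < L) {B : ℝ} (hB : 0 < B)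
    (hu : LipschitzOnWith L u Ω) (hub : ∀ x ∈ Ω, |u x| ≤ B) {δ : ℝ} (hδ : 0 < δ) :
    ∃ g ∈ ridgeSpan ι ψ, LipschitzOnWith L g Ω ∧ (∀ x ∈ Ω, |g x| ≤ B) ∧
      ∀ x ∈ Ω, |g x - u x| ≤ δ := by
  -- Shrinking `u` by the factor `1 - θ` leaves room in both constraints for the last error.
  obtain ⟨θ, hθ0, hθ1, hθδ⟩ : ∃ θ : ℝ, 0 < θ ∧ θ < 1 ∧ θ * B ≤ δ / 3 := by
    refine ⟨min (1 / 2) (δ / 3 / B), by positivity,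
      (min_le_left _ _).trans_lt (by norm_num), ?_⟩
    exact (mul_le_mul_of_nonneg_right (min_le_right _ _) hB.le).trans
      (div_mul_cancel₀ _ hB.ne').le
  have hL' : (0 : ℝ) < L := hL
  obtain ⟨c, hc⟩ : ∃ c : ℝ≥0, (c : ℝ) = 1 - θ := ⟨⟨1 - θ, by linarith⟩, rfl⟩
  have hc0 : 0 < c := by
    rw [← NNReal.coe_pos, hc]
    linarith
  have hu' : LipschitzOnWith (c * L) (fun x => (c : ℝ) * u x) Ω := by
    refine LipschitzOnWith.of_dist_le_mul fun x hx y hy => ?_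
    rw [Real.dist_eq, ← mul_sub, abs_mul, NNReal.abs_eq, NNReal.coe_mul, mul_assoc]
    exact mul_le_mul_of_nonneg_left (hu.dist_le_mul x hx y hy) c.coe_nonneg
  have hub' : ∀ x ∈ Ω, |(c : ℝ) * u x| ≤ c * B := fun x hx => by
    rw [abs_mul, NNReal.abs_eq]
    exact mul_le_mul_of_nonneg_left (hub x hx) c.coe_nonneg
  obtain ⟨v, hv, hvL, hvB, hvu⟩ := exists_mem_expSpan_approx hρ hΩ (mul_pos hc0 hL)
    (mul_nonneg c.coe_nonneg hB.le) hu' hub' (δ := δ / 3) (by positivity)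
  obtain ⟨g, hg, hgv⟩ := expSpan_le_lipClosure hψ hρ hΩ hv (min (θ * B) (θ * L))
    (by positivity)
  have hgv0 : ∀ x ∈ Ω, |v x - g x| ≤ θ * B := fun x hx => (hgv.1 x hx).trans (min_le_left _ _)
  refine ⟨g, hg, LipschitzOnWith.of_dist_le_mul fun x hx y hy => ?_, fun x hx => ?_,
    fun x hx => ?_⟩
  · have h1 := hvL.dist_le_mul x hx y hy
    have h2 := (hgv.2 x hx y hy).trans
      (mul_le_mul_of_nonneg_right (min_le_right _ _) (norm_nonneg _))
    rw [NNReal.coe_mul, hc, Real.dist_eq] at h1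
    rw [← dist_eq_norm] at h2
    have h3 := abs_sub (v x - v y) ((v - g) x - (v - g) y)
    have h4 : v x - v y - ((v - g) x - (v - g) y) = g x - g y := by
      simp only [Pi.sub_apply]
      ring
    rw [h4] at h3
    rw [Real.dist_eq]
    linarith
  · have h1 := hvB x hx
    have h2 := hgv0 x hx
    rw [hc] at h1
    rw [abs_le] at h1 h2 ⊢
    constructor <;> linarith
  · have h1 := hvu x hx
    have h2 := hgv0 x hx
    have h3 : |θ * u x| ≤ θ * B := by
      rw [abs_mul, abs_of_pos hθ0]
      exact mul_le_mul_of_nonneg_left (hub x hx) hθ0.le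
    rw [hc] at h1
    rw [abs_le] at h1 h2 h3 ⊢
    constructor <;> linarith

theorem add_mem_Ridge {d : ℕ} {ψ : ℝ → ℝ}
    {f g : EuclideanSpace ℝ ι → EuclideanSpace ℝ (Fin d)}
    (hf : f ∈ Ridge ι d ψ) (hg : g ∈ Ridge ι d ψ) : f + g ∈ Ridge ι d ψ := by
  obtain ⟨N, α, w, b, hf⟩ := hf
  obtain ⟨N', α', w', b', hg⟩ := hg
  refine ⟨N + N', Fin.append α α', Fin.append w w', Fin.append b b', fun x => ?_⟩
  simp [Fin.sum_univ_add, hf, hg]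

theorem zero_mem_Ridge {d : ℕ} {ψ : ℝ → ℝ} :
    (0 : EuclideanSpace ℝ ι → EuclideanSpace ℝ (Fin d)) ∈ Ridge ι d ψ :=
  ⟨0, 0, 0, 0, fun x => by simp⟩

theorem smul_const_mem_Ridge {d : ℕ} {ψ : ℝ → ℝ} {g : EuclideanSpace ℝ ι → ℝ}
    (hg : g ∈ ridgeSpan ι ψ) (v : EuclideanSpace ℝ (Fin d)) :
    (fun x => g x • v) ∈ Ridge ι d ψ := by
  induction hg using Submodule.span_induction generalizing v with
  | mem g hg =>
    obtain ⟨⟨w, b⟩, rfl⟩ := hg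
    exact ⟨1, fun _ => v, fun _ => w, fun _ => b, fun x => by simp⟩
  | zero =>
    simp only [Pi.zero_apply, zero_smul]
    exact zero_mem_Ridge
  | add g g' _ _ h h' =>
    convert add_mem_Ridge (h v) (h' v) using 1
    ext1 x
    exact add_smul _ _ _
  | smul c g _ h =>
    convert h (c • v) using 1
    ext1 x
    rw [Pi.smul_apply, smul_eq_mul, mul_comm, mul_smul]

theorem mem_Ridge_of_forall_mem_ridgeSpan {d : ℕ} {ψ : ℝ → ℝ}
    {g : Fin d → EuclideanSpace ℝ ι → ℝ} (hg : ∀ j, g j ∈ ridgeSpan ι ψ) :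
    (fun x => WithLp.toLp 2 fun j => g j x) ∈ Ridge ι d ψ := by
  have h : ∀ s : Finset (Fin d), (∑ j ∈ s, fun x => g j x • EuclideanSpace.single j (1 : ℝ)) ∈
      Ridge ι d ψ := by
    intro s
    induction s using Finset.induction_on with
    | empty => simpa using zero_mem_Ridge
    | insert j s hj ih =>
      rw [Finset.sum_insert hj]
      exact add_mem_Ridge (smul_const_mem_Ridge (hg j) _) ih
  convert h Finset.univ using 1
  ext x j
  simp [Finset.sum_apply, Pi.single_apply]

end

theorem exists_norm_le_of_mem_priceBox {a : ℕ} (lo hi : Fin a → ℝ) (i : ℕ) :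
    ∃ ρ : ℝ, 0 ≤ ρ ∧ ∀ x ∈ priceBox lo hi i, ‖x‖ ≤ ρ := by
  refine ⟨∑ p : Fin a × Fin i, (|lo p.1| + |hi p.1|), Finset.sum_nonneg fun p _ => by positivity,
    fun x hx => ?_⟩
  rw [EuclideanSpace.norm_eq]
  refine (Real.sqrt_le_sqrt (Finset.sum_sq_le_sq_sum_of_nonneg fun p _ => norm_nonneg _)).trans ?_
  rw [Real.sqrt_sq (Finset.sum_nonneg fun p _ => norm_nonneg _)]
  refine Finset.sum_le_sum fun p _ => ?_
  have := hx p.1 p.2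
  rw [Real.norm_eq_abs, abs_le]
  constructor
  · linarith [this.1, neg_abs_le (lo p.1), abs_nonneg (hi p.1)]
  · linarith [this.2, le_abs_self (hi p.1), abs_nonneg (lo p.1)]

theorem ridgeRestrict_subset_lipBounded {a : ℕ} (lo hi : Fin a → ℝ) (ψ : ℝ → ℝ) (i : ℕ) (B : ℝ)
    (L : ℝ≥0) : ridgeRestrict lo hi ψ i B L ⊆ lipBounded lo hi i B L := by
  rintro _ ⟨f, ⟨-, hf⟩, rfl⟩ j
  exact ⟨(lipschitzOnWith_iff_restrict.1 (hf j).1), fun x => (hf j).2 x.1 x.2⟩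

theorem lipBounded_subset_closure_ridgeRestrict {a : ℕ} (lo hi : Fin a → ℝ) {ψ : ℝ → ℝ}
    (hψ : AdmissibleActivation ψ) (i : ℕ) {B : ℝ} (hB : 0 < B) {L : ℝ≥0} (hL : 0 < L) :
    lipBounded lo hi i B L ⊆ closure (ridgeRestrict lo hi ψ i B L) := by
  intro f hf
  obtain ⟨ρ, hρ, hΩ⟩ := exists_norm_le_of_mem_priceBox lo hi i
  rw [mem_closure_iff_nhds_basis
    (UniformFun.hasBasis_nhds_of_basis _ _ f Metric.uniformity_basis_dist)]
  intro ε hε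
  let u : Fin a → PathSpace a i → ℝ := fun j =>
    Function.extend Subtype.val (fun x => UniformFun.toFun f x j) 0
  have hu : ∀ j (x : priceBox lo hi i), u j x = UniformFun.toFun f x j := fun j x =>
    Subtype.val_injective.extend_apply _ _ x
  have huL : ∀ j, LipschitzOnWith L (u j) (priceBox lo hi i) := fun j => by
    rw [lipschitzOnWith_iff_restrict]
    convert (hf j).1 using 1
    exact funext (hu j)
  have huB : ∀ j, ∀ x ∈ priceBox lo hi i, |u j x| ≤ B := fun j x hx => by
    rw [hu j ⟨x, hx⟩]
    exact (hf j).2 _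
  choose g hg hgL hgB hgu using fun j => exists_mem_ridgeSpan_approx hψ hρ hΩ hL hB (huL j) (huB j)
    (δ := ε / (a + 1)) (by positivity)
  refine ⟨UniformFun.ofFun fun x => WithLp.toLp 2 fun j => g j x.1,
    ⟨_, ⟨mem_Ridge_of_forall_mem_ridgeSpan hg, fun j => ⟨hgL j, hgB j⟩⟩, rfl⟩, fun x => ?_⟩
  change dist (UniformFun.toFun f x) (WithLp.toLp 2 fun j => g j x.1) < ε
  rw [EuclideanSpace.dist_eq]
  refine (Real.sqrt_le_sqrt (Finset.sum_sq_le_sq_sum_of_nonneg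
    fun j _ => dist_nonneg)).trans_lt ?_
  rw [Real.sqrt_sq (Finset.sum_nonneg fun j _ => dist_nonneg)]
  calc ∑ j, dist (UniformFun.toFun f x j) (g j x.1) ≤ ∑ _j : Fin a, ε / (a + 1) :=
        Finset.sum_le_sum fun j _ => by
          rw [dist_comm, Real.dist_eq, ← hu]
          exact hgu j x.1 x.2
    _ = a * (ε / (a + 1)) := by simp
    _ < ε := by
        rw [mul_div_assoc', div_lt_iff₀ (by positivity)]
        nlinarith

end RidgeDensity

theorem lemma3 {a n : ℕ} (lo hi : Fin a → ℝ) (hU : ∀ j, lo j < hi j)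
    (ψ : ℝ → ℝ) (hψ : RidgeDensity.AdmissibleActivation ψ)
    (i : ℕ) (hi1 : 1 ≤ i) (hin : i ≤ n) (B : ℝ) (hB : 0 < B) (L : ℝ≥0) (hL : 0 < L) :
    RidgeDensity.ridgeRestrict lo hi ψ i B L ⊆ RidgeDensity.lipBounded lo hi i B L ∧
      RidgeDensity.lipBounded lo hi i B L ⊆
        closure (RidgeDensity.ridgeRestrict lo hi ψ i B L) :=
  ⟨RidgeDensity.ridgeRestrict_subset_lipBounded lo hi ψ i B L,
    RidgeDensity.lipBounded_subset_closure_ridgeRestrict lo hi hψ i hB hL⟩
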